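/- **Theorem 5.2.** Let $(M,\{\cdot,\cdot\})$ be a finite-dimensional smooth Poisson manifold (Hausdorff and paracompact), let $g$ be a Riemannian metric on $M$, let $H\in C^\infty(M)$, and let $X_H$ be the Hamilton–Poisson vector field, determined by $X_H f=\{f,H\}$ for all $f\in C^\infty(M)$. Let $C_1,\dots,C_k\in C^\infty(M)$ be Casimir functions, i.e. $\{C_i,f\}=0$ for all $f\in C^\infty(M)$, and let $S$ be a regular symplectic leaf, by which we mean: $S$ is an open subset of the submanifold $\{x\in M: C_1(x)=c_1,\dots,C_k(x)=c_k\}$ for some regular value $c=(c_1,\dots,c_k)$ of $(C_1,\dots,C_k):M\to\mathbb R^k$, and $S$, with the structure of an open submanifold of this level set, is a symplectic leaf of $M$, i.e. a maximal connected integral manifold of the characteristic distribution $x\mapsto\{X_f(x): f\in C^\infty(M)\}\subset T_xM$. Let $x_e\in S$ be an equilibrium point of $X_H$, i.e. $X_H(x_e)=0$. Put $$\sigma_i(x_e)=\frac{\det\big(\langle \operatorname{grad} G^{(i)}_b(x_e),\operatorname{grad} C_a(x_e)\rangle_g\big)_{a,b=1}^k}{\det\big(\langle \operatorname{grad} C_b(x_e),\operatorname{grad}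 C_a(x_e)\rangle_g\big)_{a,b=1}^k},\qquad G^{(i)}_b=\begin{cases}H,& b=i,\\ C_b,& b\ne i,\end{cases}$$ and let $\operatorname{Hess}$ denote the Riemannian Hessian, given in local coordinates by $[\operatorname{Hess}F]_{uv}=\frac{\partial^2F}{\partial x^u\partial x^v}-\Gamma^w_{uv}\frac{\partial F}{\partial x^w}$ with the Christoffel symbols $\Gamma^w_{uv}$ of $g$. If the bilinear form $$\Big(\operatorname{Hess}H(x_e)-\sum_{i=1}^k\sigma_i(x_e)\operatorname{Hess}C_i(x_e)\Big)\Big|_{T_{x_e}S\times T_{x_e}S}$$ is positive definite, then $x_e$ is Lyapunov stable for the dynamics generated by $X_H$ on all of $M$: for every neighbourhood $U$ of $x_e$ in $M$ there is a neighbourhood $V$ of $x_e$ in $M$ such that every solution of $\dot x=X_H(x)$ that starts in $V$ exists for all times $t\ge 0$ and remains in $U$. -/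

import Mathlib

open scoped Manifold ContDiff Topology

noncomputable section

namespace HamiltonPoisson

variable {n : ℕ} {M : Type*} [TopologicalSpace M] [ChartedSpace (EuclideanSpace ℝ (Fin n)) M]

/-! ### Poisson manifolds -/

/-- The algebra of smooth real-valued functions on `M`. -/
abbrev SmoothFun (n : ℕ) (M : Type*) [TopologicalSpace M]
    [ChartedSpace (EuclideanSpace ℝ (Fin n)) M] : Type _ :=
  C^∞⟮𝓡 n, M; ℝ⟯

/-- The differential `df_x : T_x M → ℝ` of a real function. -/
abbrev differential (n : ℕ) {M : Type*} [TopologicalSpace M]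
    [ChartedSpace (EuclideanSpace ℝ (Fin n)) M] (f : M → ℝ) (x : M) (v : TangentSpace (𝓡 n) x) :
    ℝ :=
  mfderiv (𝓡 n) 𝓘(ℝ, ℝ) f x v

/-- A Poisson structure: a Lie bracket on the smooth functions which is a derivation in each
argument. -/
structure PoissonStructure (n : ℕ) (M : Type*) [TopologicalSpace M]
    [ChartedSpace (EuclideanSpace ℝ (Fin n)) M] where
  /-- The Poisson bracket `{f, g}`, which is bilinear over `ℝ`. -/
  bracket : SmoothFun n M →ₗ[ℝ] SmoothFun n M →ₗ[ℝ] SmoothFun n M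
  skew : ∀ f g, bracket f g = - bracket g f
  jacobi : ∀ f g h,
    bracket f (bracket g h) + bracket g (bracket h f) + bracket h (bracket f g) = 0
  leibniz : ∀ f g h, bracket (f * g) h = f * bracket g h + g * bracket f h

namespace PoissonStructure

variable (P : PoissonStructure n M)

/-- `X` is the Hamilton–Poisson vector field `X_H`, i.e. the vector field determined by
`X_H f = {f, H}` for all smooth `f`. -/
def IsHamiltonianVectorField (H : SmoothFun n M) (X : ∀ x : M, TangentSpace (𝓡 n) x) : Prop :=
  ∀ (f : SmoothFun n M) (x : M), differential n f x (X x) = P.bracket f H x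

/-- Casimir functions: they Poisson-commute with every smooth function. -/
def IsCasimir (C : SmoothFun n M) : Prop := ∀ f, P.bracket C f = 0

/-- The characteristic subspace at `x`: the set of all values `X_f(x)` at `x` of Hamiltonian vector
fields. -/
def characteristicSpace (x : M) : Set (TangentSpace (𝓡 n) x) :=
  {v | ∃ f : SmoothFun n M, ∀ h : SmoothFun n M, differential n h x v = P.bracket h f x}

end PoissonStructure

/-! ### Tangent spaces of submanifolds, regular values, symplectic leaves -/

/-- The tangent space `T_x S` of a submanifold `S` of `M`: the velocities at time `0` of the curves
through `x` that run in `S`. -/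
def tangentTo (S : Set M) (x : M) : Set (TangentSpace (𝓡 n) x) :=
  {v | ∃ γ : ℝ → M, γ 0 = x ∧ (∀ᶠ t in 𝓝 0, γ t ∈ S) ∧
    HasMFDerivAt 𝓘(ℝ, ℝ) (𝓡 n) γ 0 ((1 : ℝ →L[ℝ] ℝ).smulRight v)}

/-- The level set `C⁻¹(c)` of a map `C = (C_1, …, C_k)`. -/
def levelSet {k : ℕ} (C : Fin k → SmoothFun n M) (c : Fin k → ℝ) : Set M :=
  {x | ∀ i, C i x = c i}

/-- `c` is a regular value of `C = (C_1, …, C_k) : M → ℝ^k`: the differential of `C` is onto at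
every point of `C⁻¹(c)`. -/
def IsRegularValue {k : ℕ} (C : Fin k → SmoothFun n M) (c : Fin k → ℝ) : Prop :=
  ∀ x ∈ levelSet C c,
    Function.Surjective fun (v : TangentSpace (𝓡 n) x) (i : Fin k) => differential n (C i) x v

/-- `S` is a regular symplectic leaf for the Casimirs `C_1, …, C_k`: it is an open subset of the
submanifold `C⁻¹(c)` for a regular value `c` of `C`, and with this submanifold structure it is a
symplectic leaf, i.e. a maximal connected integral manifold of the characteristic distribution.
(A connected integral manifold is maximal exactly if the trajectories of the Hamiltonian vector
fields cannot leave it; replacing `f` by a multiple, it is enough to look at time `1`.) -/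
structure IsRegularSymplecticLeaf (P : PoissonStructure n M) {k : ℕ} (C : Fin k → SmoothFun n M)
    (S : Set M) : Prop where
  isOpen_in_regular_level :
    ∃ c : Fin k → ℝ, IsRegularValue C c ∧ ∃ U : Set M, IsOpen U ∧ S = U ∩ levelSet C c
  isConnected : IsConnected S
  tangent_eq : ∀ x ∈ S, tangentTo (n := n) S x = P.characteristicSpace x
  maximal : ∀ (f : SmoothFun n M) (X : ∀ x : M, TangentSpace (𝓡 n) x),
    P.IsHamiltonianVectorField f X → ∀ γ : ℝ → M, IsMIntegralCurveOn γ X (Set.Icc 0 1) →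
      γ 0 ∈ S → γ 1 ∈ S

/-! ### Riemannian gradient, Lagrange multipliers and Hessian -/

section Riemannian

variable [IsManifold (𝓡 n) ∞ M]

/-- Smooth Riemannian metrics on `M`. -/
abbrev RiemannianMetricOn (n : ℕ) (M : Type*) [TopologicalSpace M]
    [ChartedSpace (EuclideanSpace ℝ (Fin n)) M] [IsManifold (𝓡 n) ∞ M] : Type _ :=
  Bundle.ContMDiffRiemannianMetric (𝓡 n) ∞ (EuclideanSpace ℝ (Fin n))
    (fun x : M => TangentSpace (𝓡 n) x)

variable (g : RiemannianMetricOn n M)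

theorem exists_grad (f : M → ℝ) (x : M) :
    ∃ u : TangentSpace (𝓡 n) x, ∀ w, g.inner x u w = differential n f x w := by
  have : FiniteDimensional ℝ (TangentSpace (𝓡 n) x) :=
    inferInstanceAs (FiniteDimensional ℝ (EuclideanSpace ℝ (Fin n)))
  let B : TangentSpace (𝓡 n) x →ₗ[ℝ] Module.Dual ℝ (TangentSpace (𝓡 n) x) :=
    (ContinuousLinearMap.coeLM ℝ) ∘ₗ (g.inner x).toLinearMap
  have hB : Function.Injective B := by
    rw [injective_iff_map_eq_zero]
    intro u hu
    by_contra h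
    have h1 := g.pos x u h
    have h2 : g.inner x u u = 0 := LinearMap.congr_fun hu u
    linarith
  have hs : Function.Surjective B :=
    (LinearMap.injective_iff_surjective_of_finrank_eq_finrank
      (Subspace.dual_finrank_eq (K := ℝ)).symm).1 hB
  obtain ⟨u, hu⟩ := hs (mfderiv (𝓡 n) 𝓘(ℝ, ℝ) f x).toLinearMap
  exact ⟨u, fun w => LinearMap.congr_fun hu w⟩

/-- The Riemannian gradient: `⟨grad f (x), w⟩ = df_x(w)` for all `w`. -/
def grad (f : M → ℝ) (x : M) : TangentSpace (𝓡 n) x := (exists_grad g f x).choose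

theorem inner_grad (f : M → ℝ) (x : M) (w : TangentSpace (𝓡 n) x) :
    g.inner x (grad g f x) w = differential n f x w :=
  (exists_grad g f x).choose_spec w

/-- The Gramian matrix with `(a, b)` entry `⟨grad h_b, grad f_a⟩`. -/
def gramian {k : ℕ} (f h : Fin k → M → ℝ) (x : M) : Matrix (Fin k) (Fin k) ℝ :=
  Matrix.of fun a b => g.inner x (grad g (h b) x) (grad g (f a) x)

/-- The Lagrange multiplier function
`σ_i = det Σ^{(F_1,…,F_k)}_{(F_1,…,F_{i-1},G,F_{i+1},…,F_k)} / det Σ^{(F_1,…,F_k)}_{(F_1,…,F_k)}`. -/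
def lagrangeMultiplier {k : ℕ} (F : Fin k → M → ℝ) (G : M → ℝ) (i : Fin k) (x : M) : ℝ :=
  (gramian g F (Function.update F i G) x).det / (gramian g F F x).det

/-- The partial derivative `∂f/∂x^u` on the coordinate space. -/
def partialDeriv (u : Fin n) (f : EuclideanSpace ℝ (Fin n) → ℝ) (y : EuclideanSpace ℝ (Fin n)) :
    ℝ :=
  fderiv ℝ f y (EuclideanSpace.single u 1)

/-- The coordinate vector field `∂/∂x^u` of the chart at `x`, at the point with coordinates `y`. -/
def coordVector (x : M) (y : EuclideanSpace ℝ (Fin n)) (u : Fin n) :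
    TangentSpace (𝓡 n) ((extChartAt (𝓡 n) x).symm y) :=
  mfderiv 𝓘(ℝ, EuclideanSpace ℝ (Fin n)) (𝓡 n) (extChartAt (𝓡 n) x).symm y
    (EuclideanSpace.single u (1 : ℝ) : EuclideanSpace ℝ (Fin n))

/-- The matrix `g_{uv}` of the metric in the chart at `x`, as a function of the coordinates. -/
def metricMatrix (x : M) (y : EuclideanSpace ℝ (Fin n)) : Matrix (Fin n) (Fin n) ℝ :=
  Matrix.of fun u v =>
    g.inner ((extChartAt (𝓡 n) x).symm y) (coordVector x y u) (coordVector x y v)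

/-- The Christoffel symbols `Γ^w_{uv}` of the Levi-Civita connection, at the point `x`, in the chart
at `x`. -/
def christoffel (x : M) (w u v : Fin n) : ℝ :=
  let y := extChartAt (𝓡 n) x x
  (1 / 2) * ∑ l, (metricMatrix g x y)⁻¹ w l *
    (partialDeriv u (fun z => metricMatrix g x z v l) y
      + partialDeriv v (fun z => metricMatrix g x z u l) y
      - partialDeriv l (fun z => metricMatrix g x z u v) y)

/-- The Hessian matrix `∂²G/∂x^u∂x^v - Γ^w_{uv} ∂G/∂x^w` at the point `x`, in the chart at `x`. -/
def hessMatrix (G : M → ℝ) (x : M) : Matrix (Fin n) (Fin n) ℝ :=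
  let y := extChartAt (𝓡 n) x x
  let Gc : EuclideanSpace ℝ (Fin n) → ℝ := G ∘ (extChartAt (𝓡 n) x).symm
  Matrix.of fun u v => partialDeriv u (partialDeriv v Gc) y
    - ∑ w, christoffel g x w u v * partialDeriv w Gc y

/-- The coordinates of a tangent vector at `x` in the chart at `x`. -/
def coords (x : M) (η : TangentSpace (𝓡 n) x) : EuclideanSpace ℝ (Fin n) :=
  mfderiv (𝓡 n) 𝓘(ℝ, EuclideanSpace ℝ (Fin n)) (extChartAt (𝓡 n) x) x η

/-- The Riemannian Hessian `Hess G (x)` as a bilinear form on `T_x M`. -/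
def hess (G : M → ℝ) (x : M) (η ξ : TangentSpace (𝓡 n) x) : ℝ :=
  ∑ u, ∑ v, coords x η u * coords x ξ v * hessMatrix g G x u v

end Riemannian

/-! ### Lyapunov stability -/

/-- `x_e` is a (Lyapunov) stable equilibrium of the dynamics on `M` generated by `X`: the solutions
that start close to `x_e` exist for all times `t ≥ 0` and stay close to `x_e`. -/
def IsStableEquilibrium (X : ∀ x : M, TangentSpace (𝓡 n) x) (xe : M) : Prop :=
  X xe = 0 ∧ ∀ U ∈ 𝓝 xe, ∃ V ∈ 𝓝 xe, ∀ x₀ ∈ V,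
    (∃ γ : ℝ → M, γ 0 = x₀ ∧ IsMIntegralCurveOn γ X (Set.Ici 0)) ∧
    ∀ (γ : ℝ → M) (T : ℝ), γ 0 = x₀ → IsMIntegralCurveOn γ X (Set.Icc 0 T) →
      ∀ t ∈ Set.Icc 0 T, γ t ∈ U

end HamiltonPoisson

end

noncomputable section

namespace HamiltonPoisson

/-! ### Analysis in normed spaces: strict minima, penalties, level-set curves, trapped flows. -/

section Analysis

variable {E : Type*} [NormedAddCommGroup E] [NormedSpace ℝ E]

/-! The proof is Lyapunov's direct method with a conserved function having a strict local minimum at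
`xe` on all of `M`, not only on the leaf: Φ = H - ∑ σ_i C_i + (K/2) ∑ (C_i - C_i(xe))².

Φ is conserved because {H,H} = 0 and {C_i,H} = 0. At an equilibrium dH kills the characteristic
space, which is the tangent space of the leaf and contains ⋂ ker dC_i. So dH = ∑ σ_i dC_i at `xe`,
and Cramer's rule identifies these σ_i with the quotients of Gram determinants
(`lagrangeMultiplier_eq`). Hence `xe` is critical for H - ∑ σ_i C_i, the Christoffel terms cancel
(`hess_self_eq`), and the hypothesis says that the coordinate second derivative of this function is
positive on ⋂ ker dC_i. For large K the penalty term makes it positive in all directions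
(`exists_penalty`, `exists_strict_min_augmented`).

By compactness Φ exceeds its value at `xe` by a uniform gap on a small coordinate sphere, so
solutions starting at lower values cannot cross it. Global solutions come from cutting the field off
in the chart (`exists_trapped_integralCurve`). This needs the field to be C¹, which follows from its
components being brackets of localized coordinates with H (`exists_contDiffOn_localField`). -/

theorem exists_gap_of_isCompact {X : Type*} [TopologicalSpace X] {K : Set X} (hK : IsCompact K)
    {φ : X → ℝ} (hφ : ContinuousOn φ K) {a : ℝ} (h : ∀ y ∈ K, a < φ y) :
    ∃ m, a < m ∧ ∀ y ∈ K, m ≤ φ y := by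
  rcases K.eq_empty_or_nonempty with rfl | hne
  · exact ⟨a + 1, by linarith, by simp⟩
  · obtain ⟨z, hz, hmin⟩ := hK.exists_isMinOn hne hφ
    exact ⟨φ z, h z hz, fun y hy => hmin hy⟩

/-- A positive definite quadratic form on a finite-dimensional space is coercive. -/
theorem exists_coercive [FiniteDimensional ℝ E] (D : E →L[ℝ] E →L[ℝ] ℝ)
    (hD : ∀ v, v ≠ 0 → 0 < D v v) : ∃ c > 0, ∀ v, c * ‖v‖ ^ 2 ≤ D v v := by
  obtain ⟨c, hc, hmin⟩ := exists_gap_of_isCompact (isCompact_sphere (0 : E) 1)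
    (φ := fun v => D v v) (by fun_prop) (a := 0)
    (fun v hv => hD v (by rintro rfl; simp at hv))
  refine ⟨c, hc, fun v => ?_⟩
  rcases eq_or_ne v 0 with rfl | hv
  · simp
  have hv' : ‖v‖ ≠ 0 := norm_ne_zero_iff.2 hv
  have h := hmin (‖v‖⁻¹ • v) (by simp [norm_smul, hv'])
  simp only [map_smul, smul_apply, smul_eq_mul] at h
  have h2 : ‖v‖ ^ 2 * (‖v‖⁻¹ * (‖v‖⁻¹ * D v v)) = D v v := by field_simp
  nlinarith [mul_le_mul_of_nonneg_left h (sq_nonneg ‖v‖)]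

/-- The second derivative test: a critical point with positive definite second derivative is a
strict local minimum. -/
theorem exists_strict_min_of_hessian_pos [FiniteDimensional ℝ E] {f : E → ℝ} {y₀ : E}
    {D : E →L[ℝ] E →L[ℝ] ℝ} (hf : ∀ᶠ y in 𝓝 y₀, DifferentiableAt ℝ f y)
    (hf0 : fderiv ℝ f y₀ = 0) (hD : HasFDerivAt (fderiv ℝ f) D y₀)
    (hpos : ∀ v, v ≠ 0 → 0 < D v v) :
    ∃ r > 0, ∀ y ∈ Metric.closedBall y₀ r, y ≠ y₀ → f y₀ < f y := by
  obtain ⟨c, hc, hcoer⟩ := exists_coercive D hpos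
  -- Half of the coercivity constant is spent on the linearization error, so the derivative of f
  -- along the ray y₀ + t v is at least t (c/2) ‖v‖².
  have h1 := hD.isLittleO.def (half_pos hc)
  obtain ⟨r, hr, hball⟩ := Metric.eventually_nhds_iff_ball.1 (hf.and h1)
  refine ⟨r / 2, half_pos hr, fun y hy hne => ?_⟩
  set v := y - y₀ with hv
  have hv0 : v ≠ 0 := sub_ne_zero.2 hne
  have hnv : 0 < ‖v‖ := norm_pos_iff.2 hv0
  have hmem : ∀ t ∈ Set.Icc (0 : ℝ) 1, y₀ + t • v ∈ Metric.ball y₀ r := by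
    intro t ht
    rw [Metric.mem_closedBall, dist_eq_norm] at hy
    rw [Metric.mem_ball, dist_eq_norm, add_sub_cancel_left, norm_smul, Real.norm_eq_abs,
      abs_of_nonneg ht.1]
    nlinarith [ht.2, norm_nonneg v]
  have hder : ∀ t ∈ Set.Icc (0 : ℝ) 1,
      HasDerivAt (fun t : ℝ => f (y₀ + t • v)) (fderiv ℝ f (y₀ + t • v) v) t := by
    intro t ht
    have hc : HasDerivAt (fun t : ℝ => y₀ + t • v) v t := by
      simpa using ((hasDerivAt_id t).smul_const v).const_add y₀
    exact (hball _ (hmem t ht)).1.hasFDerivAt.comp_hasDerivAt t hc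
  have hmono : StrictMonoOn (fun t : ℝ => f (y₀ + t • v)) (Set.Icc 0 1) := by
    refine strictMonoOn_of_deriv_pos (convex_Icc 0 1)
      (fun t ht => (hder t ht).continuousAt.continuousWithinAt) fun t ht => ?_
    rw [interior_Icc] at ht
    have htI := Set.Ioo_subset_Icc_self ht
    rw [(hder t htI).deriv]
    have h2 := (hball _ (hmem t htI)).2
    simp only [hf0, sub_zero, add_sub_cancel_left, map_smul] at h2
    have h3 := (fderiv ℝ f (y₀ + t • v) - t • D v).le_opNorm v
    simp only [sub_apply, smul_apply, smul_eq_mul,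
      Real.norm_eq_abs] at h3
    rw [norm_smul, Real.norm_eq_abs, abs_of_pos ht.1] at h2
    have h4 := (abs_le.1 (h3.trans (mul_le_mul_of_nonneg_right h2 hnv.le))).1
    have h5 := mul_le_mul_of_nonneg_left (hcoer v) ht.1.le
    have h6 : 0 < t * (c / 2 * ‖v‖ ^ 2) := mul_pos ht.1 (by positivity)
    nlinarith
  have := hmono (Set.left_mem_Icc.2 zero_le_one) (Set.right_mem_Icc.2 zero_le_one) zero_lt_one
  simpa [hv] using this

/-- A quadratic form which is positive definite on the common kernel of finitely many linear
functionals becomes positive definite after adding a multiple of the sum of their squares. -/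
theorem exists_penalty [FiniteDimensional ℝ E] {ι : Type*} [Fintype ι] (D : E →L[ℝ] E →L[ℝ] ℝ)
    (ℓ : ι → E →L[ℝ] ℝ) (hD : ∀ v, v ≠ 0 → (∀ i, ℓ i v = 0) → 0 < D v v) :
    ∃ K : ℝ, ∀ v, v ≠ 0 → 0 < D v v + K * ∑ i, ℓ i v ^ 2 := by
  -- The penalty is needed only where D v v ≤ 0 on the unit sphere; there the functionals have no
  -- common zero, so compactness bounds the sum of squares below by m > 0.
  set A : Set E := Metric.sphere 0 1 ∩ {v | D v v ≤ 0} with hA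
  have hAc : IsCompact A :=
    (isCompact_sphere 0 1).inter_right (isClosed_le (by fun_prop) continuous_const)
  obtain ⟨m, hm, hmin⟩ := exists_gap_of_isCompact hAc (φ := fun v => ∑ i, ℓ i v ^ 2)
    (by fun_prop) (a := 0) (by
      rintro v ⟨hv1, hv2⟩
      by_contra! hle
      have h0 := (Finset.sum_eq_zero_iff_of_nonneg (fun i _ => sq_nonneg (ℓ i v))).1
        (le_antisymm hle (Finset.sum_nonneg fun i _ => sq_nonneg _))
      refine absurd (hD v (by rintro rfl; simp at hv1) fun i => ?_) (not_lt.2 hv2)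
      exact pow_eq_zero_iff two_ne_zero |>.1 (h0 i (Finset.mem_univ i)))
  obtain ⟨q, -, hq⟩ := exists_gap_of_isCompact (isCompact_sphere (0 : E) 1)
    (φ := fun v => -|D v v|) (by fun_prop) (a := -(‖D‖ + 1)) (by
      intro v hv
      have h1 : ‖v‖ = 1 := by simpa using hv
      have h2 := D.le_opNorm₂ v v
      simp only [h1, mul_one, Real.norm_eq_abs] at h2
      linarith)
  -- On `A` the penalty is at least |q| + 1 while D w w ≥ -|q|; off `A` the form is already
  -- positive. Homogeneity extends this from the sphere to all v.
  refine ⟨(|q| + 1) / m, fun v hv => ?_⟩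
  have hnv : 0 < ‖v‖ := norm_pos_iff.2 hv
  set w := ‖v‖⁻¹ • v with hw
  have hws : w ∈ Metric.sphere (0 : E) 1 := by simp [hw, norm_smul, hnv.ne']
  have hS : 0 ≤ ∑ i, ℓ i w ^ 2 := Finset.sum_nonneg fun i _ => sq_nonneg _
  have hK : 0 < (|q| + 1) / m := by positivity
  have hwpos : 0 < D w w + (|q| + 1) / m * ∑ i, ℓ i w ^ 2 := by
    by_cases hle : D w w ≤ 0
    · have h1 := mul_le_mul_of_nonneg_left (hmin w ⟨hws, hle⟩) hK.le
      rw [div_mul_cancel₀ _ hm.ne'] at h1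
      have h2 := hq w hws
      have h3 := neg_abs_le (D w w)
      have h4 := neg_abs_le q
      linarith
    · push Not at hle
      have := mul_nonneg hK.le hS
      linarith
  have hvw : v = ‖v‖ • w := by simp [hw, smul_smul, hnv.ne']
  have : D v v + (|q| + 1) / m * ∑ i, ℓ i v ^ 2
      = ‖v‖ ^ 2 * (D w w + (|q| + 1) / m * ∑ i, ℓ i w ^ 2) := by
    conv_lhs => rw [hvw]
    simp only [map_smul, smul_apply, smul_eq_mul, mul_pow, ← Finset.mul_sum]
    ring
  rw [this]
  positivity

/-- A compactly supported `C¹` vector field on a Banach space has global integral curves. -/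
theorem exists_global_integralCurve [CompleteSpace E] {Y : E → E} (hY : ContDiff ℝ 1 Y)
    (hc : HasCompactSupport Y) (x : E) :
    ∃ γ : ℝ → E, γ 0 = x ∧ ∀ t, HasDerivAt γ (Y (γ t)) t := by
  obtain ⟨B, hB⟩ := hc.exists_bound_of_continuous hY.continuous
  obtain ⟨K, hK⟩ := hY.lipschitzWith_of_hasCompactSupport hc one_ne_zero
  have key : ∃ γ : ℝ → E, γ 0 = x ∧ IsMIntegralCurve (I := 𝓘(ℝ, E)) γ Y := by
    refine (exists_isMIntegralCurve_iff_exists_isMIntegralCurveOn_Ioo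
      (contMDiff_vectorSpace_iff_contDiff.2 hY) x).2 fun a => ?_
    -- This T is positive even for negative a, and (-a, a) lies in the open interval (-T, T), where
    -- one-sided derivatives are two-sided.
    let T : ℝ := |a| + 1
    have hT : 0 < T := by positivity
    -- At speed at most B a curve moves at most B T in time T, and Y is globally Lipschitz, so the
    -- ball of radius B T works for every T.
    have hPL : IsPicardLindelof (fun _ => Y)
        (⟨0, by simp [hT.le], hT.le⟩ : Set.Icc (-T) T) x (B.toNNReal * T.toNNReal) 0
        B.toNNReal K := by
      refine .of_time_independent (fun y _ => (hB y).trans (Real.le_coe_toNNReal B))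
        hK.lipschitzOnWith ?_
      simp [hT.le]
    obtain ⟨γ, h0, hγ⟩ := hPL.exists_eq_forall_mem_Icc_hasDerivWithinAt₀
    refine ⟨γ, h0, fun t ht => ?_⟩
    have hat : a ≤ |a| := le_abs_self a
    have h1 : -T < t := by simp only [T]; linarith [ht.1]
    have h2 : t < T := by simp only [T]; linarith [ht.2]
    exact ((hγ t ⟨h1.le, h2.le⟩).hasDerivAt
      (Icc_mem_nhds h1 h2)).hasFDerivAt.hasMFDerivAt.hasMFDerivWithinAt
  obtain ⟨γ, h0, hγ⟩ := key
  exact ⟨γ, h0, fun t => (hγ t).hasFDerivAt⟩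

/-- Every direction in the kernel of a surjective derivative is the velocity of a curve in the
level set. -/
theorem exists_curve_in_level [CompleteSpace E] {F : Type*} [NormedAddCommGroup F]
    [NormedSpace ℝ F] [FiniteDimensional ℝ F] {f : E → F} {f' : E →L[ℝ] F} {a : E}
    (hf : HasStrictFDerivAt f f' a) (hs : Function.Surjective f') {v : E} (hv : f' v = 0) :
    ∃ γ : ℝ → E, γ 0 = a ∧ (∀ᶠ t in 𝓝 0, f (γ t) = f a) ∧ HasDerivAt γ v 0 := by
  have : CompleteSpace F := FiniteDimensional.complete ℝ F
  have hr : f'.range = ⊤ := LinearMap.range_eq_top.2 hs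
  let w : f'.ker := ⟨v, hv⟩
  have hline : HasDerivAt (fun t : ℝ => t • w) w 0 := by
    simpa using (hasDerivAt_id (0 : ℝ)).smul_const w
  have hlim : Filter.Tendsto (fun t : ℝ => t • w) (𝓝 0) (𝓝 0) := by
    simpa using hline.continuousAt.tendsto
  -- The implicit function parametrizes the fibre through a by the kernel of f', with derivative the
  -- inclusion at 0; the curve is the image of the line t w.
  refine ⟨fun t => hf.implicitFunction f f' hr (f a) (t • w), ?_, ?_, ?_⟩
  · simp [hf.implicitFunction_apply_image hr]
  · have h := hf.map_implicitFunction_eq hr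
    have h2 : Filter.Tendsto (fun t : ℝ => (f a, t • w)) (𝓝 0) (𝓝 (f a, (0 : f'.ker))) :=
      (tendsto_const_nhds.prodMk_nhds hlim)
    exact h2.eventually h
  · have h := (hf.to_implicitFunction hr).hasFDerivAt
    have h0 : (fun t : ℝ => t • w) 0 = 0 := by simp
    rw [← h0] at h
    exact h.comp_hasDerivAt (0 : ℝ) hline

/-- A continuous path which starts in an open set and avoids its topological boundary stays in the
open set. -/
theorem mapsTo_of_disjoint_boundary {X : Type*} [TopologicalSpace X] {γ : ℝ → X} {s : Set ℝ}
    (hs : IsPreconnected s) (hγ : ContinuousOn γ s) {B K : Set X} (hB : IsOpen B) (hK : IsClosed K)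
    (hBK : B ⊆ K) (havoid : ∀ t ∈ s, γ t ∉ K \ B) {t₀ : ℝ} (ht₀ : t₀ ∈ s) (h0 : γ t₀ ∈ B) :
    ∀ t ∈ s, γ t ∈ B := by
  have h : γ '' s ⊆ B := by
    refine (hs.image γ hγ).subset_left_of_subset_union hB hK.isOpen_compl
      (Set.disjoint_compl_right_iff_subset.2 hBK) ?_ ⟨γ t₀, Set.mem_image_of_mem γ ht₀, h0⟩
    rintro _ ⟨t, ht, rfl⟩
    by_cases hb : γ t ∈ B
    · exact Or.inl hb
    · exact Or.inr fun hk => havoid t ht ⟨hk, hb⟩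
  exact fun t ht => h (Set.mem_image_of_mem γ ht)

/-- Solutions of an autonomous differential equation with a conserved quantity that exceeds its
value at `y₀` on a sphere around `y₀` exist globally, and stay in the ball, if they start close to
`y₀`. -/
theorem exists_trapped_integralCurve [FiniteDimensional ℝ E] {Y : E → E} {φ : E → ℝ} {y₀ : E}
    {r R : ℝ} (hr : 0 < r) (hrR : r < R) (hY : ContDiffOn ℝ 1 Y (Metric.ball y₀ R))
    (hφ : DifferentiableOn ℝ φ (Metric.ball y₀ R))
    (hcons : ∀ y ∈ Metric.ball y₀ R, fderiv ℝ φ y (Y y) = 0)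
    (hmin : ∀ y ∈ Metric.sphere y₀ r, φ y₀ < φ y) :
    ∃ V ∈ 𝓝 y₀, ∀ x ∈ V, ∃ γ : ℝ → E, γ 0 = x ∧
      ∀ t, γ t ∈ Metric.ball y₀ r ∧ HasDerivAt γ (Y (γ t)) t := by
  have : CompleteSpace E := FiniteDimensional.complete ℝ E
  have hsub : Metric.closedBall y₀ r ⊆ Metric.ball y₀ R := Metric.closedBall_subset_ball hrR
  obtain ⟨r₁, hr₁, hr₁R⟩ := exists_between hrR
  obtain ⟨r₂, hr₂, hr₂R⟩ := exists_between hr₁R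
  obtain ⟨r₃, hr₃, hr₃R⟩ := exists_between hr₂R
  -- With r < r₁ < r₂ < r₃ < R, β cuts off the field inside r₁ and β' cuts off φ only beyond r₂.
  -- Thus ψ = β' φ agrees with φ wherever β Y is nonzero, and is conserved by β Y on the whole
  -- space.
  let β : ContDiffBump y₀ := ⟨r, r₁, hr, hr₁⟩
  let β' : ContDiffBump y₀ := ⟨r₂, r₃, by linarith, hr₃⟩
  have hball : ∀ y ∈ Metric.ball y₀ R, Metric.ball y₀ R ∈ 𝓝 y :=
    fun y hy => Metric.isOpen_ball.mem_nhds hy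
  have hZ : ContDiff ℝ 1 (fun y => β y • Y y) := by
    refine contDiff_iff_contDiffAt.2 fun y => ?_
    by_cases hy : y ∈ Metric.ball y₀ R
    · exact β.contDiff.contDiffAt.smul ((hY y hy).contDiffAt (hball y hy))
    · have hout : y ∉ tsupport β := by
        rw [β.tsupport_eq]
        exact fun h => hy (Metric.closedBall_subset_ball hr₁R h)
      have h0 : (fun y => β y • Y y) =ᶠ[𝓝 y] fun _ => 0 := by
        filter_upwards [notMem_tsupport_iff_eventuallyEq.1 hout] with z hz
        simp [hz]
      exact contDiffAt_const.congr_of_eventuallyEq h0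
  have hZc : HasCompactSupport (fun y => β y • Y y) := β.hasCompactSupport.smul_right
  set ψ : E → ℝ := fun y => β' y * φ y with hψ
  have hψd : Differentiable ℝ ψ := by
    intro y
    by_cases hy : y ∈ Metric.ball y₀ R
    · exact (β'.contDiff (n := 1)).differentiable one_ne_zero y |>.mul
        ((hφ y hy).differentiableAt (hball y hy))
    · have hout : y ∉ tsupport β' := by
        rw [β'.tsupport_eq]
        exact fun h => hy (Metric.closedBall_subset_ball hr₃R h)
      have h0 : ψ =ᶠ[𝓝 y] fun _ => 0 := by
        filter_upwards [notMem_tsupport_iff_eventuallyEq.1 hout] with z hz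
        simp [hψ, hz]
      exact (differentiableAt_const _).congr_of_eventuallyEq h0
  have hψφ : ∀ y ∈ Metric.ball y₀ r₂, ψ =ᶠ[𝓝 y] φ := by
    intro y hy
    filter_upwards [Metric.isOpen_ball.mem_nhds hy] with z hz
    have : β' z = 1 := β'.one_of_mem_closedBall (Metric.ball_subset_closedBall hz)
    simp [hψ, this]
  have hψcons : ∀ y, fderiv ℝ ψ y (β y • Y y) = 0 := by
    intro y
    by_cases hy : y ∈ Metric.ball y₀ r₂
    · rw [(hψφ y hy).fderiv_eq, map_smul, hcons y (Metric.ball_subset_ball hr₂R.le hy), smul_zero]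
    · have : β y = 0 := β.zero_of_le_dist (by
        rw [Metric.mem_ball, not_lt] at hy
        exact hr₂.le.trans hy)
      simp [this]
  have hcb : Metric.closedBall y₀ r ⊆ Metric.ball y₀ r₂ :=
    Metric.closedBall_subset_ball (hr₁.trans hr₂)
  obtain ⟨m, hm, hmle⟩ := exists_gap_of_isCompact (isCompact_sphere y₀ r)
    (hφ.continuousOn.mono (Metric.sphere_subset_closedBall.trans hsub)) hmin
  have hcont : ContinuousAt φ y₀ :=
    ((hφ y₀ (Metric.mem_ball_self (hr.trans hrR))).differentiableAt
      (Metric.ball_mem_nhds y₀ (hr.trans hrR))).continuousAt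
  refine ⟨{x | φ x < m} ∩ Metric.ball y₀ r,
    Filter.inter_mem (hcont.eventually_lt continuousAt_const hm) (Metric.ball_mem_nhds y₀ hr),
    fun x hx => ?_⟩
  obtain ⟨γ, h0, hγ⟩ := exists_global_integralCurve hZ hZc x
  have hconst : ∀ t, ψ (γ t) = ψ (γ 0) := by
    have hd : ∀ t, HasDerivAt (fun t => ψ (γ t)) 0 t := fun t => by
      have := (hψd (γ t)).hasFDerivAt.comp_hasDerivAt t (hγ t)
      rwa [hψcons] at this
    exact fun t => is_const_of_deriv_eq_zero (fun t => (hd t).differentiableAt)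
      (fun t => (hd t).deriv) t 0
  have hin : ∀ t ∈ Set.univ, γ t ∈ Metric.ball y₀ r := by
    refine mapsTo_of_disjoint_boundary isPreconnected_univ
      (continuous_iff_continuousAt.2 fun t => (hγ t).continuousAt).continuousOn
      Metric.isOpen_ball Metric.isClosed_closedBall Metric.ball_subset_closedBall
      (fun t _ ht => ?_) (Set.mem_univ 0) (h0 ▸ hx.2)
    rw [Metric.closedBall_sdiff_ball] at ht
    have h1 := hmle _ ht
    have h2 := hconst t
    rw [(hψφ _ (hcb (Metric.sphere_subset_closedBall ht))).self_of_nhds, h0,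
      (hψφ _ (hcb (Metric.ball_subset_closedBall hx.2))).self_of_nhds] at h2
    exact absurd hx.1 (by simp [← h2, h1])
  refine ⟨γ, h0, fun t => ⟨hin t trivial, ?_⟩⟩
  have h1 : β (γ t) = 1 := β.one_of_mem_closedBall (Metric.ball_subset_closedBall (hin t trivial))
  simpa [h1] using hγ t

end Analysis

/-! ### Functions, tangent vectors and curves in a chart. -/

section

variable {n : ℕ} {M : Type*} [TopologicalSpace M] [ChartedSpace (EuclideanSpace ℝ (Fin n)) M]

theorem differential_eq_of_eventuallyEq {f g : M → ℝ} {p : M} (h : f =ᶠ[𝓝 p] g)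
    (v : TangentSpace (𝓡 n) p) : differential n f p v = differential n g p v := by
  simp only [differential, h.mfderiv_eq]
  rfl

section Chart

variable [IsManifold (𝓡 n) ∞ M]

/-- The representative of a function in the chart at `x`. -/
abbrev localRep (x : M) (f : M → ℝ) : EuclideanSpace ℝ (Fin n) → ℝ :=
  f ∘ (extChartAt (𝓡 n) x).symm

/-- The derivative of the chart at `x` as a map from `T_p M` to the coordinate space. -/
abbrev chartDeriv (x p : M) : TangentSpace (𝓡 n) p →L[ℝ] EuclideanSpace ℝ (Fin n) :=
  mfderiv (𝓡 n) 𝓘(ℝ, EuclideanSpace ℝ (Fin n)) (extChartAt (𝓡 n) x) p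

theorem contDiffOn_localRep (x : M) (f : SmoothFun n M) :
    ContDiffOn ℝ ∞ (localRep x f) (extChartAt (𝓡 n) x).target :=
  contMDiffOn_iff_contDiffOn.1
    (f.contMDiff.comp_contMDiffOn (contMDiffOn_extChartAt_symm (I := 𝓡 n) (n := ∞) x))

theorem contDiffAt_localRep (x : M) (f : SmoothFun n M) {y : EuclideanSpace ℝ (Fin n)}
    (hy : y ∈ (extChartAt (𝓡 n) x).target) : ContDiffAt ℝ ∞ (localRep x f) y :=
  (contDiffOn_localRep x f).contDiffAt ((isOpen_extChartAt_target x).mem_nhds hy)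

theorem differentiableAt_localRep (x : M) (f : SmoothFun n M) {y : EuclideanSpace ℝ (Fin n)}
    (hy : y ∈ (extChartAt (𝓡 n) x).target) : DifferentiableAt ℝ (localRep x f) y :=
  (contDiffAt_localRep x f hy).differentiableAt (by simp)

theorem differentiableAt_fderiv_localRep (x : M) (f : SmoothFun n M)
    {y : EuclideanSpace ℝ (Fin n)} (hy : y ∈ (extChartAt (𝓡 n) x).target) :
    DifferentiableAt ℝ (fderiv ℝ (localRep x f)) y :=
  ((contDiffAt_localRep x f hy).fderiv_right (m := 1)
    (by norm_cast)).differentiableAt one_ne_zero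

theorem hasMFDerivAt_extChartAt_chartDeriv {x p : M} (hp : p ∈ (extChartAt (𝓡 n) x).source) :
    HasMFDerivAt (𝓡 n) 𝓘(ℝ, EuclideanSpace ℝ (Fin n)) (extChartAt (𝓡 n) x) p
      (chartDeriv x p) :=
  (mdifferentiableAt_extChartAt (by rwa [← extChartAt_source (𝓡 n)])).hasMFDerivAt

theorem differential_comp_extChartAt {x p : M} (hp : p ∈ (extChartAt (𝓡 n) x).source)
    {f : EuclideanSpace ℝ (Fin n) → ℝ} (hf : DifferentiableAt ℝ f (extChartAt (𝓡 n) x p))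
    (v : TangentSpace (𝓡 n) p) :
    differential n (f ∘ extChartAt (𝓡 n) x) p v
      = fderiv ℝ f (extChartAt (𝓡 n) x p) (chartDeriv x p v) := by
  have h := HasMFDerivAt.comp p hf.hasFDerivAt.hasMFDerivAt (hasMFDerivAt_extChartAt_chartDeriv hp)
  rw [differential, h.mfderiv]
  rfl

theorem differential_eq_fderiv_localRep {x p : M} (hp : p ∈ (extChartAt (𝓡 n) x).source)
    (f : SmoothFun n M) (v : TangentSpace (𝓡 n) p) :
    differential n f p v
      = fderiv ℝ (localRep x f) (extChartAt (𝓡 n) x p) (chartDeriv x p v) := by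
  rw [← differential_comp_extChartAt hp
    (differentiableAt_localRep x f ((extChartAt (𝓡 n) x).map_source hp))]
  refine differential_eq_of_eventuallyEq ?_ v
  filter_upwards [extChartAt_source_mem_nhds' hp] with q hq
  exact (congrArg f ((extChartAt (𝓡 n) x).left_inv hq)).symm

/-- A differentiable curve in the coordinate space is mapped by the inverse chart to a curve in the
manifold with the corresponding velocity. -/
theorem hasMFDerivAt_symm_comp {x p : M} {c : ℝ → EuclideanSpace ℝ (Fin n)} {t : ℝ}
    (ht : c t ∈ (extChartAt (𝓡 n) x).target) (hp : (extChartAt (𝓡 n) x).symm (c t) = p)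
    (v : TangentSpace (𝓡 n) p) (hc : HasDerivAt c (chartDeriv x p v) t) :
    HasMFDerivAt 𝓘(ℝ, ℝ) (𝓡 n) ((extChartAt (𝓡 n) x).symm ∘ c) t
      ((1 : ℝ →L[ℝ] ℝ).smulRight v : ℝ →L[ℝ] TangentSpace (𝓡 n) p) := by
  subst hp
  have h1 : MDifferentiableAt 𝓘(ℝ, EuclideanSpace ℝ (Fin n)) (𝓡 n)
      (extChartAt (𝓡 n) x).symm (c t) := by
    have := mdifferentiableWithinAt_extChartAt_symm (I := 𝓡 n) ht
    rwa [ModelWithCorners.range_eq_univ, mdifferentiableWithinAt_univ] at this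
  have h2 := mfderivWithin_extChartAt_symm_comp_mfderiv_extChartAt (I := 𝓡 n) ht
  rw [ModelWithCorners.range_eq_univ, mfderivWithin_univ] at h2
  have h3 := HasMFDerivAt.comp t h1.hasMFDerivAt hc.hasFDerivAt.hasMFDerivAt
  have h4 := DFunLike.congr_fun h2 v
  refine h3.congr_mfderiv (ContinuousLinearMap.ext fun s : ℝ => ?_)
  have h5 : mfderiv 𝓘(ℝ, EuclideanSpace ℝ (Fin n)) (𝓡 n) (extChartAt (𝓡 n) x).symm (c t)
      (s • chartDeriv x ((extChartAt (𝓡 n) x).symm (c t)) v) = s • v :=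
    (map_smul _ s _).trans (congrArg (s • ·) h4)
  exact h5

/-- At its own base point the chart has the identity as derivative, so coordinate vectors may be
replaced by tangent vectors. -/
theorem chartDeriv_self_surjective (x : M) : Function.Surjective (chartDeriv (n := n) x x) := by
  intro w
  refine ⟨w, ?_⟩
  rw [chartDeriv, mfderiv_extChartAt_self]
  rfl

end Chart

end

/-! ### Hessian in coordinates and Gram determinants. -/

section

variable {n : ℕ} {M : Type*} [TopologicalSpace M] [ChartedSpace (EuclideanSpace ℝ (Fin n)) M]

theorem euclidean_eq_sum (η : EuclideanSpace ℝ (Fin n)) :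
    η = ∑ u, η u • EuclideanSpace.single u (1 : ℝ) := by
  ext i
  simp [Finset.sum_apply, Pi.single_apply]

theorem bilin_apply_eq_sum
    (D : EuclideanSpace ℝ (Fin n) →L[ℝ] EuclideanSpace ℝ (Fin n) →L[ℝ] ℝ)
    (η : EuclideanSpace ℝ (Fin n)) :
    D η η = ∑ u, ∑ v, η u * η v *
      D (EuclideanSpace.single u (1 : ℝ)) (EuclideanSpace.single v (1 : ℝ)) := by
  conv_lhs => rw [euclidean_eq_sum η]
  simp only [map_sum, map_smul, sum_apply, smul_apply, smul_eq_mul, Finset.mul_sum, mul_assoc]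
  rw [Finset.sum_comm]
  exact Finset.sum_congr rfl fun u _ => Finset.sum_congr rfl fun v _ => by ring

section Hessian

variable [IsManifold (𝓡 n) ∞ M] (g : RiemannianMetricOn n M)

/-- The vector `Γ^w_{uv} η^u η^v`. -/
def christoffelVector (x : M) (η : EuclideanSpace ℝ (Fin n)) : EuclideanSpace ℝ (Fin n) :=
  ∑ w, (∑ u, ∑ v, η u * η v * christoffel g x w u v) • EuclideanSpace.single w (1 : ℝ)

/-- The Christoffel contribution depends on G only through its first derivative, so it cancels in
any combination of functions that is critical at x. -/
theorem hess_self_eq (G : SmoothFun n M) (x : M) (ξ : TangentSpace (𝓡 n) x) :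
    hess g G x ξ ξ
      = fderiv ℝ (fderiv ℝ (localRep x G)) (extChartAt (𝓡 n) x x) (chartDeriv x x ξ)
          (chartDeriv x x ξ)
        - fderiv ℝ (localRep x G) (extChartAt (𝓡 n) x x)
          (christoffelVector g x (chartDeriv x x ξ)) := by
  have hd := differentiableAt_fderiv_localRep x G (mem_extChartAt_target (I := 𝓡 n) x)
  have h2 : ∀ u v : Fin n, partialDeriv u (partialDeriv v (localRep x G)) (extChartAt (𝓡 n) x x)
      = fderiv ℝ (fderiv ℝ (localRep x G)) (extChartAt (𝓡 n) x x)
        (EuclideanSpace.single u (1 : ℝ)) (EuclideanSpace.single v (1 : ℝ)) := by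
    intro u v
    have := (hd.hasFDerivAt.clm_apply
      (hasFDerivAt_const (EuclideanSpace.single v (1 : ℝ)) (extChartAt (𝓡 n) x x))).fderiv
    change fderiv ℝ (fun z => fderiv ℝ (localRep x G) z (EuclideanSpace.single v (1 : ℝ))) _ _ = _
    rw [this]
    simp
  have h3 : ∀ η : EuclideanSpace ℝ (Fin n),
      fderiv ℝ (localRep x G) (extChartAt (𝓡 n) x x) (christoffelVector g x η)
      = ∑ u, ∑ v, η u * η v *
        ∑ w, christoffel g x w u v * partialDeriv w (localRep x G) (extChartAt (𝓡 n) x x) := by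
    intro η
    simp only [christoffelVector, map_sum, map_smul, smul_eq_mul, partialDeriv, Finset.sum_mul,
      Finset.mul_sum]
    rw [Finset.sum_comm]
    refine Finset.sum_congr rfl fun u _ => ?_
    rw [Finset.sum_comm]
    exact Finset.sum_congr rfl fun v _ => Finset.sum_congr rfl fun w _ => by ring
  rw [bilin_apply_eq_sum, h3, ← Finset.sum_sub_distrib]
  simp only [hess, hessMatrix, coords, Matrix.of_apply]
  refine Finset.sum_congr rfl fun u _ => ?_
  rw [← Finset.sum_sub_distrib]
  refine Finset.sum_congr rfl fun v _ => ?_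
  rw [mul_sub, ← h2]
  rfl

/-- If `dG = ∑ λ_i dF_i` at `x` with `dF_1, …, dF_k` linearly independent, then the quotients of
Gram determinants recover the multipliers `λ_i`. -/
theorem lagrangeMultiplier_eq {k : ℕ} (F : Fin k → M → ℝ) (G : M → ℝ) (x : M) (c : Fin k → ℝ)
    (hF : Function.Surjective fun (v : TangentSpace (𝓡 n) x) (i : Fin k) => differential n (F i) x v)
    (hG : ∀ v, differential n G x v = ∑ i, c i * differential n (F i) x v) (i : Fin k) :
    lagrangeMultiplier g F G i x = c i := by
  have hentry : ∀ (f h : Fin k → M → ℝ) a b,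
      gramian g f h x a b = differential n (h b) x (grad g (f a) x) :=
    fun f h a b => inner_grad g (h b) x _
  -- Since dG = ∑ c_j dF_j, exchanging F_i for G replaces column i by the Gram matrix applied to c:
  -- the setting of Cramer's rule.
  have hcol : gramian g F (Function.update F i G) x
      = (gramian g F F x).updateCol i ((gramian g F F x).mulVec c) := by
    ext a b
    rcases eq_or_ne b i with rfl | hb
    · rw [hentry, Matrix.updateCol_self, Function.update_self, hG]
      exact Finset.sum_congr rfl fun j _ =>
        (mul_comm _ _).trans (congrArg (· * c j) (hentry F F a j).symm)
    · rw [hentry, Matrix.updateCol_ne hb, Function.update_of_ne hb, hentry]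
  -- For μ in the kernel, u = ∑ μ_b grad F_b is orthogonal to itself, hence zero; testing against w
  -- with dF(w) = μ gives ∑ μ_b² = 0.
  have hdet : (gramian g F F x).det ≠ 0 := by
    intro h0
    obtain ⟨μ, hμ, hzero⟩ := Matrix.exists_mulVec_eq_zero_iff.2 h0
    set u : TangentSpace (𝓡 n) x := ∑ b, μ b • grad g (F b) x with hu
    have hinner : ∀ w, g.inner x u w = ∑ b, μ b * differential n (F b) x w := by
      intro w
      rw [hu, map_sum, sum_apply]
      exact Finset.sum_congr rfl fun b _ => by
        rw [map_smul, smul_apply, inner_grad, smul_eq_mul]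
    have hgrad : ∀ a, g.inner x u (grad g (F a) x) = 0 := by
      intro a
      rw [hinner]
      have := congrFun hzero a
      rw [Matrix.mulVec, dotProduct, Pi.zero_apply] at this
      rw [← this]
      exact Finset.sum_congr rfl fun b _ => by rw [hentry, mul_comm]
    have hself : g.inner x u u = 0 := by
      conv_lhs => rw [hu, map_sum]
      exact Finset.sum_eq_zero fun a _ => by rw [map_smul, ← hu, hgrad, smul_zero]
    have hu0 : u = 0 := by
      by_contra hne
      exact (g.pos x u hne).ne' hself
    obtain ⟨w, hw⟩ := hF μ
    have h1 := hinner w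
    rw [hu0, map_zero, zero_apply] at h1
    have h2 : ∑ b, μ b * μ b = 0 := by
      rw [h1]
      exact Finset.sum_congr rfl fun b _ => by rw [← congrFun hw b]
    refine hμ (funext fun b => ?_)
    exact mul_self_eq_zero.1
      ((Finset.sum_eq_zero_iff_of_nonneg fun j _ => mul_self_nonneg (μ j)).1 h2 b (Finset.mem_univ b))
  rw [lagrangeMultiplier, hcol, ← Matrix.cramer_apply, Matrix.cramer_eq_adjugate_mulVec,
    Matrix.mulVec_mulVec, Matrix.adjugate_mul, Matrix.smul_mulVec, Matrix.one_mulVec,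
    Pi.smul_apply, smul_eq_mul, mul_div_cancel_left₀ _ hdet]

end Hessian

/-! ### Tangent vectors of regular level sets. -/

section Level

variable [IsManifold (𝓡 n) ∞ M]

/-- The common kernel of the differentials `dC_i` at a point of an open piece of a regular level
set consists of tangent vectors of this level set. -/
theorem mem_tangentTo_of_regular {k : ℕ} {C : Fin k → SmoothFun n M} {c : Fin k → ℝ}
    (hc : IsRegularValue C c) {U : Set M} (hU : IsOpen U) {x : M} (hx : x ∈ U ∩ levelSet C c)
    {v : TangentSpace (𝓡 n) x} (hv : ∀ i, differential n (C i) x v = 0) :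
    v ∈ tangentTo (n := n) (U ∩ levelSet C c) x := by
  set y₀ := extChartAt (𝓡 n) x x with hy₀
  have hy : y₀ ∈ (extChartAt (𝓡 n) x).target := mem_extChartAt_target x
  have hxs : x ∈ (extChartAt (𝓡 n) x).source := mem_extChartAt_source x
  have hsymm : (extChartAt (𝓡 n) x).symm y₀ = x := (extChartAt (𝓡 n) x).left_inv hxs
  have hstrict : HasStrictFDerivAt (fun y i => localRep x (C i) y)
      (ContinuousLinearMap.pi fun i => fderiv ℝ (localRep x (C i)) y₀) y₀ :=
    hasStrictFDerivAt_pi.2 fun i =>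
      (contDiffAt_localRep x (C i) hy).hasStrictFDerivAt (by simp)
  have hsurj : Function.Surjective
      (ContinuousLinearMap.pi fun i => fderiv ℝ (localRep x (C i)) y₀) := by
    intro b
    obtain ⟨w, hw⟩ := hc x hx.2 b
    refine ⟨chartDeriv x x w, ?_⟩
    rw [← hw]
    funext i
    exact (differential_eq_fderiv_localRep hxs (C i) w).symm
  obtain ⟨γ, h0, hlev, hder⟩ := exists_curve_in_level hstrict hsurj
    (v := chartDeriv x x v) (by
      funext i
      exact (differential_eq_fderiv_localRep hxs (C i) v).symm.trans (hv i))
  have hder' := hasMFDerivAt_symm_comp (x := x) (p := x) (c := γ) (t := 0) (by rwa [h0])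
    (by rw [h0, hsymm]) v hder
  have hγ0 : ((extChartAt (𝓡 n) x).symm ∘ γ) 0 = x := by rw [Function.comp_apply, h0, hsymm]
  refine ⟨(extChartAt (𝓡 n) x).symm ∘ γ, hγ0, ?_, hder'⟩
  have hcont : ContinuousAt ((extChartAt (𝓡 n) x).symm ∘ γ) 0 := hder'.continuousAt
  have hUnear : ∀ᶠ t in 𝓝 (0 : ℝ), ((extChartAt (𝓡 n) x).symm ∘ γ) t ∈ U :=
    hcont.eventually_mem (hU.mem_nhds (by rw [hγ0]; exact hx.1))
  filter_upwards [hUnear, hlev] with t ht1 ht2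
  refine ⟨ht1, fun i => ?_⟩
  have h1 := congrFun ht2 i
  simp only [localRep, Function.comp_apply, hsymm] at h1
  exact h1.trans (hx.2 i)

end Level

/-! ### Equilibria and conserved quantities. -/

namespace PoissonStructure

variable (P : PoissonStructure n M)

theorem bracket_self (H : SmoothFun n M) (x : M) : P.bracket H H x = 0 := by
  have h : P.bracket H H x = - P.bracket H H x := congrArg (fun f : SmoothFun n M => f x) (P.skew H H)
  linarith

/-- If `X_H(x) = 0`, then `dH` vanishes on the characteristic space at `x`. -/
theorem differential_eq_zero_of_equilibrium {P : PoissonStructure n M} {H : SmoothFun n M}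
    {X : ∀ x : M, TangentSpace (𝓡 n) x} (hX : P.IsHamiltonianVectorField H X) {x : M}
    (hx : X x = 0) {v : TangentSpace (𝓡 n) x} (hv : v ∈ P.characteristicSpace x) :
    differential n H x v = 0 := by
  obtain ⟨f, hf⟩ := hv
  -- By skew-symmetry dH(v) = {H,f} = -{f,H} = -df(X x), which vanishes at the equilibrium.
  have h1 : P.bracket H f x = - P.bracket f H x :=
    congrArg (fun f : SmoothFun n M => f x) (P.skew H f)
  have h2 := hX f x
  rw [hx, differential, map_zero] at h2
  rw [hf H, h1, ← h2]
  exact neg_zero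

end PoissonStructure

/-- If the differential of `f` vanishes along `X`, then `f` is constant along integral curves. -/
theorem eq_of_isMIntegralCurveOn {f : SmoothFun n M} {X : ∀ x : M, TangentSpace (𝓡 n) x}
    (hf : ∀ x, differential n f x (X x) = 0) {γ : ℝ → M} {T : ℝ}
    (hγ : IsMIntegralCurveOn γ X (Set.Icc 0 T)) {t : ℝ} (ht : t ∈ Set.Icc 0 T) :
    f (γ t) = f (γ 0) := by
  have hd : ∀ s ∈ Set.Icc 0 T, HasDerivWithinAt (fun s => f (γ s)) 0 (Set.Icc 0 T) s := by
    intro s hs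
    have hdiff : MDifferentiableAt (𝓡 n) 𝓘(ℝ, ℝ) f (γ s) :=
      f.contMDiff.mdifferentiable (by simp) (γ s)
    have h := hdiff.hasMFDerivAt.comp_hasMFDerivWithinAt s (hγ s hs)
    have h0 : (mfderiv (𝓡 n) 𝓘(ℝ, ℝ) f (γ s)).comp ((1 : ℝ →L[ℝ] ℝ).smulRight (X (γ s))) = 0 := by
      refine ContinuousLinearMap.ext fun a : ℝ => ?_
      have h1 : mfderiv (𝓡 n) 𝓘(ℝ, ℝ) f (γ s) (X (γ s)) = 0 := hf (γ s)
      have h2 : mfderiv (𝓡 n) 𝓘(ℝ, ℝ) f (γ s) (a • X (γ s)) = 0 := by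
        rw [map_smul, h1, smul_zero]
      exact h2
    have h' : HasFDerivWithinAt (fun s => f (γ s)) (0 : ℝ →L[ℝ] ℝ) (Set.Icc 0 T) s :=
      (h.congr_mfderiv h0).hasFDerivWithinAt
    simpa using h'.hasDerivWithinAt
  exact constant_of_has_deriv_right_zero (fun s hs => (hd s hs).continuousWithinAt)
    (fun s hs => ((hd s ⟨hs.1, hs.2.le⟩).mono_of_mem_nhdsWithin
      (Icc_mem_nhdsGE_of_mem hs))) t ht

/-! ### Smoothness of Hamiltonian vector fields. -/

section VectorField

variable [IsManifold (𝓡 n) ∞ M]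

/-- The representative of a vector field in the chart at `x`. -/
def localField (x : M) (X : ∀ p : M, TangentSpace (𝓡 n) p) (y : EuclideanSpace ℝ (Fin n)) :
    EuclideanSpace ℝ (Fin n) :=
  chartDeriv x ((extChartAt (𝓡 n) x).symm y) (X ((extChartAt (𝓡 n) x).symm y))

theorem fderiv_localRep_localField {x : M} {X : ∀ p : M, TangentSpace (𝓡 n) p}
    (f : SmoothFun n M) {y : EuclideanSpace ℝ (Fin n)} (hy : y ∈ (extChartAt (𝓡 n) x).target) :
    fderiv ℝ (localRep x f) y (localField x X y)
      = differential n f ((extChartAt (𝓡 n) x).symm y) (X ((extChartAt (𝓡 n) x).symm y)) := by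
  rw [differential_eq_fderiv_localRep ((extChartAt (𝓡 n) x).map_target hy),
    (extChartAt (𝓡 n) x).right_inv hy]
  rfl

/-- Hamiltonian vector fields are smooth in charts. -/
theorem exists_contDiffOn_localField [T2Space M] {P : PoissonStructure n M} {H : SmoothFun n M}
    {X : ∀ x : M, TangentSpace (𝓡 n) x} (hX : P.IsHamiltonianVectorField H X) (x : M) :
    ∀ᶠ R in 𝓝[>] (0 : ℝ), Metric.ball (extChartAt (𝓡 n) x x) R ⊆ (extChartAt (𝓡 n) x).target ∧
      ContDiffOn ℝ 1 (localField x X) (Metric.ball (extChartAt (𝓡 n) x x) R) := by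
  obtain ⟨ρ⟩ : Nonempty (SmoothBumpFunction (𝓡 n) x) := inferInstance
  have hcoord : ∀ i : Fin n, ContMDiffOn (𝓡 n) 𝓘(ℝ, ℝ) ∞ (fun p => extChartAt (𝓡 n) x p i)
      (chartAt (EuclideanSpace ℝ (Fin n)) x).source := fun i =>
    (EuclideanSpace.proj (𝕜 := ℝ) i).contDiff.contMDiff.comp_contMDiffOn
      (contMDiffOn_extChartAt (I := 𝓡 n) (n := ∞) (x := x))
  -- Bump times coordinate is a global smooth function, so near x the i-th component of the field is
  -- the smooth function {f_i, H}. The bump must equal 1 near each point considered, since the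
  -- differential depends on the germ.
  let f : Fin n → SmoothFun n M := fun i => ⟨_, ρ.contMDiff_smul (hcoord i)⟩
  have hnear : ∀ᶠ p in 𝓝 x, ∀ᶠ q in 𝓝 p, ρ q = 1 :=
    eventually_eventually_nhds.2 ρ.eventuallyEq_one
  have hcs : Filter.Tendsto (extChartAt (𝓡 n) x).symm (𝓝 (extChartAt (𝓡 n) x x)) (𝓝 x) := by
    have := continuousAt_extChartAt_symm (I := 𝓡 n) x
    rwa [ContinuousAt, (extChartAt (𝓡 n) x).left_inv (mem_extChartAt_source x)] at this
  have hloc : ∀ᶠ y in 𝓝 (extChartAt (𝓡 n) x x), y ∈ (extChartAt (𝓡 n) x).target ∧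
      ∀ i, localField x X y i = localRep x (P.bracket (f i) H) y := by
    filter_upwards [extChartAt_target_mem_nhds (I := 𝓡 n) x, hcs.eventually hnear] with y hy hρ
    refine ⟨hy, fun i => ?_⟩
    have hsrc := (extChartAt (𝓡 n) x).map_target hy
    have h1 := hX (f i) ((extChartAt (𝓡 n) x).symm y)
    have h2 : (f i : M → ℝ) =ᶠ[𝓝 ((extChartAt (𝓡 n) x).symm y)]
        (EuclideanSpace.proj (𝕜 := ℝ) i) ∘ extChartAt (𝓡 n) x := by
      filter_upwards [hρ] with q hq
      change ρ q • extChartAt (𝓡 n) x q i = extChartAt (𝓡 n) x q i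
      rw [hq, one_smul]
    rw [differential_eq_of_eventuallyEq h2, differential_comp_extChartAt hsrc
      (EuclideanSpace.proj (𝕜 := ℝ) i).differentiableAt, ContinuousLinearMap.fderiv] at h1
    exact h1
  obtain ⟨R₀, hR₀, hball⟩ := Metric.eventually_nhds_iff_ball.1 hloc
  filter_upwards [Ioo_mem_nhdsGT hR₀] with R hR
  have hsub := Metric.ball_subset_ball (x := extChartAt (𝓡 n) x x) hR.2.le
  refine ⟨fun y hy => (hball y (hsub hy)).1, contDiffOn_euclidean.2 fun i => ?_⟩
  exact (((contDiffOn_localRep x (P.bracket (f i) H)).of_le (by simp)).mono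
    fun y hy => (hball y (hsub hy)).1).congr fun y hy => (hball y (hsub hy)).2 i

end VectorField

end

/-! ### Augmented functions and the constrained second derivative test. -/

section

/-- The augmented function `h - ∑ σ_i q_i + (K / 2) ∑ (q_i - a_i)²`. -/
def augmented {X ι : Type*} [Fintype ι] (h : X → ℝ) (q : ι → X → ℝ) (σ a : ι → ℝ) (K : ℝ)
    (x : X) : ℝ :=
  h x - ∑ i, σ i * q i x + K / 2 * ∑ i, (q i x - a i) ^ 2

section Augmented

variable {E ι : Type*} [NormedAddCommGroup E] [NormedSpace ℝ E] [Fintype ι]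

theorem hasFDerivAt_augmented {h : E → ℝ} {q : ι → E → ℝ} (σ a : ι → ℝ) (K : ℝ) {y : E}
    (hh : DifferentiableAt ℝ h y) (hq : ∀ i, DifferentiableAt ℝ (q i) y) :
    HasFDerivAt (augmented h q σ a K)
      (fderiv ℝ h y - ∑ i, σ i • fderiv ℝ (q i) y
        + K • ∑ i, (q i y - a i) • fderiv ℝ (q i) y) y := by
  have h1 : HasFDerivAt (fun y => ∑ i, σ i * q i y) (∑ i, σ i • fderiv ℝ (q i) y) y :=
    HasFDerivAt.fun_sum fun i _ => (hq i).hasFDerivAt.const_mul (σ i)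
  have h2 : HasFDerivAt (fun y => ∑ i, (q i y - a i) ^ 2)
      (∑ i, (2 * (q i y - a i)) • fderiv ℝ (q i) y) y :=
    HasFDerivAt.fun_sum fun i _ => by
      simpa using ((hq i).hasFDerivAt.sub_const (a i)).pow 2
  refine ((hh.hasFDerivAt.sub h1).add (h2.const_mul (K / 2))).congr_fderiv ?_
  congr 1
  rw [Finset.smul_sum, Finset.smul_sum]
  refine Finset.sum_congr rfl fun i _ => ?_
  rw [smul_smul, smul_smul]
  congr 1
  ring

/-- Constrained second derivative test: if `y₀` is critical for `h - ∑ σ_i q_i` and the second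
derivative is positive definite on the common kernel of the `dq_i`, then `y₀` is a strict local
minimum of an augmented function. -/
theorem exists_strict_min_augmented [FiniteDimensional ℝ E] {h : E → ℝ} {q : ι → E → ℝ}
    (σ : ι → ℝ) {y₀ : E}
    (hh : ∀ᶠ y in 𝓝 y₀, DifferentiableAt ℝ h y)
    (hq : ∀ᶠ y in 𝓝 y₀, ∀ i, DifferentiableAt ℝ (q i) y)
    (hh' : DifferentiableAt ℝ (fderiv ℝ h) y₀) (hq' : ∀ i, DifferentiableAt ℝ (fderiv ℝ (q i)) y₀)
    (hcrit : fderiv ℝ h y₀ = ∑ i, σ i • fderiv ℝ (q i) y₀)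
    (hpos : ∀ v, v ≠ 0 → (∀ i, fderiv ℝ (q i) y₀ v = 0) →
      0 < fderiv ℝ (fderiv ℝ h) y₀ v v - ∑ i, σ i * fderiv ℝ (fderiv ℝ (q i)) y₀ v v) :
    ∃ K : ℝ, ∃ r > 0, ∀ y ∈ Metric.closedBall y₀ r, y ≠ y₀ →
      augmented h q σ (fun i => q i y₀) K y₀ < augmented h q σ (fun i => q i y₀) K y := by
  set D : E →L[ℝ] E →L[ℝ] ℝ :=
    fderiv ℝ (fderiv ℝ h) y₀ - ∑ i, σ i • fderiv ℝ (fderiv ℝ (q i)) y₀ with hD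
  have hDv : ∀ v, D v v = fderiv ℝ (fderiv ℝ h) y₀ v v
      - ∑ i, σ i * fderiv ℝ (fderiv ℝ (q i)) y₀ v v := by
    intro v
    simp [hD, sum_apply]
  obtain ⟨K, hK⟩ := exists_penalty D (fun i => fderiv ℝ (q i) y₀)
    (fun v hv hker => by rw [hDv]; exact hpos v hv hker)
  refine ⟨K, ?_⟩
  have hformula : ∀ᶠ y in 𝓝 y₀, HasFDerivAt (augmented h q σ (fun i => q i y₀) K)
      (fderiv ℝ h y - ∑ i, σ i • fderiv ℝ (q i) y
        + K • ∑ i, (q i y - q i y₀) • fderiv ℝ (q i) y) y := by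
    filter_upwards [hh, hq] with y h1 h2 using hasFDerivAt_augmented σ _ K h1 h2
  have hder : HasFDerivAt (fun y => fderiv ℝ h y - ∑ i, σ i • fderiv ℝ (q i) y
        + K • ∑ i, (q i y - q i y₀) • fderiv ℝ (q i) y)
      (D + K • ∑ i, (fderiv ℝ (q i) y₀).smulRight (fderiv ℝ (q i) y₀)) y₀ := by
    -- The factor q_i - q_i(y₀) vanishes at y₀, so no second derivative of q_i survives, only dq_i ⊗
    -- dq_i, which is the penalty.
    have hsq : HasFDerivAt (fun y => ∑ i, (q i y - q i y₀) • fderiv ℝ (q i) y)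
        (∑ i, (fderiv ℝ (q i) y₀).smulRight (fderiv ℝ (q i) y₀)) y₀ :=
      HasFDerivAt.fun_sum fun i _ =>
        (((hq.self_of_nhds i).hasFDerivAt.sub_const (q i y₀)).fun_smul
          (hq' i).hasFDerivAt).congr_fderiv (by simp)
    exact (hh'.hasFDerivAt.fun_sub (HasFDerivAt.fun_sum fun i _ =>
      (hq' i).hasFDerivAt.fun_const_smul (σ i))).fun_add (hsq.fun_const_smul K)
  refine exists_strict_min_of_hessian_pos
    (D := D + K • ∑ i, (fderiv ℝ (q i) y₀).smulRight (fderiv ℝ (q i) y₀))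
    (hformula.mono fun y hy => hy.differentiableAt) ?_
    (hder.congr_of_eventuallyEq (hformula.mono fun y hy => hy.fderiv)) fun v hv => ?_
  · rw [hformula.self_of_nhds.fderiv, hcrit]
    simp
  · have := hK v hv
    simpa [sum_apply, pow_two] using this

end Augmented

/-- Source of the Lagrange multipliers: a functional vanishing on a finite common kernel lies in the
span. -/
theorem exists_coeff_of_ker_le {V ι : Type*} [AddCommGroup V] [Module ℝ V] [Fintype ι]
    (L : ι → V →ₗ[ℝ] ℝ) (K : V →ₗ[ℝ] ℝ) (h : ∀ v, (∀ i, L i v = 0) → K v = 0) :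
    ∃ c : ι → ℝ, ∀ v, K v = ∑ i, c i * L i v := by
  have hmem : K ∈ Submodule.span ℝ (Set.range L) :=
    mem_span_of_iInf_ker_le_ker fun v hv => h v fun i => (Submodule.mem_iInf _).1 hv i
  obtain ⟨c, hc⟩ := (Submodule.mem_span_range_iff_exists_fun ℝ).1 hmem
  exact ⟨c, fun v => by rw [← hc]; simp⟩

/-! ### Stability from a strict minimum of a conserved function. -/

variable {n : ℕ} {M : Type*} [TopologicalSpace M] [ChartedSpace (EuclideanSpace ℝ (Fin n)) M]
  [IsManifold (𝓡 n) ∞ M]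

/-- If in the chart at `xe` a function built from conserved quantities has a strict local minimum
at the equilibrium `xe` of a vector field that is `C¹` in this chart, then `xe` is stable. -/
theorem isStableEquilibrium_of_strict_min [T2Space M] {X : ∀ x : M, TangentSpace (𝓡 n) x} {xe : M}
    (heq : X xe = 0)
    (hsmooth : ∀ᶠ R in 𝓝[>] (0 : ℝ),
      Metric.ball (extChartAt (𝓡 n) xe xe) R ⊆ (extChartAt (𝓡 n) xe).target ∧
      ContDiffOn ℝ 1 (localField xe X) (Metric.ball (extChartAt (𝓡 n) xe xe) R))
    {k : ℕ} {H : SmoothFun n M} {C : Fin k → SmoothFun n M}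
    (hH : ∀ x, differential n H x (X x) = 0) (hC : ∀ i x, differential n (C i) x (X x) = 0)
    {σ a : Fin k → ℝ} {K r₀ : ℝ} (hr₀ : 0 < r₀)
    (hmin : ∀ y ∈ Metric.closedBall (extChartAt (𝓡 n) xe xe) r₀, y ≠ extChartAt (𝓡 n) xe xe →
      augmented (localRep xe H) (fun i => localRep xe (C i)) σ a K (extChartAt (𝓡 n) xe xe)
        < augmented (localRep xe H) (fun i => localRep xe (C i)) σ a K y) :
    IsStableEquilibrium X xe := by
  refine ⟨heq, fun U hU => ?_⟩
  set φ := extChartAt (𝓡 n) xe with hφ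
  set y₀ := φ xe with hy₀
  set Φ : M → ℝ := augmented H (fun i => C i) σ a K with hΦ
  have hxs : xe ∈ φ.source := mem_extChartAt_source xe
  have hsymm : φ.symm y₀ = xe := φ.left_inv hxs
  have hcs : ContinuousAt φ.symm y₀ := continuousAt_extChartAt_symm xe
  obtain ⟨δ, hδ, hδU⟩ := Metric.eventually_nhds_iff_ball.1
    (hcs.eventually_mem (by rw [hsymm]; exact hU))
  obtain ⟨R, ⟨hRt, hRs⟩, hR⟩ := (hsmooth.and self_mem_nhdsWithin).exists
  have hR : 0 < R := hR
  -- R keeps the field C¹, r₀ keeps the minimum strict, and δ keeps the ball inside U.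
  obtain ⟨r, hr, hrlt⟩ := exists_between (lt_min hR (lt_min hr₀ hδ))
  have hrR : r < R := hrlt.trans_le (min_le_left _ _)
  have hrr₀ : r < r₀ := hrlt.trans_le ((min_le_right _ _).trans (min_le_left _ _))
  have hrδ : r < δ := hrlt.trans_le ((min_le_right _ _).trans (min_le_right _ _))
  have hcbt : Metric.closedBall y₀ r ⊆ φ.target :=
    (Metric.closedBall_subset_ball hrR).trans hRt
  have hsphere : ∀ y ∈ Metric.sphere y₀ r, (Φ ∘ φ.symm) y₀ < (Φ ∘ φ.symm) y := fun y hy =>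
    hmin y (Metric.closedBall_subset_closedBall hrr₀.le (Metric.sphere_subset_closedBall hy))
      (Metric.ne_of_mem_sphere hy hr.ne')
  have hfd : ∀ y ∈ φ.target, HasFDerivAt (Φ ∘ φ.symm) (fderiv ℝ (localRep xe H) y
      - ∑ i, σ i • fderiv ℝ (localRep xe (C i)) y
      + K • ∑ i, (localRep xe (C i) y - a i) • fderiv ℝ (localRep xe (C i)) y) y := fun y hy =>
    hasFDerivAt_augmented σ a K (differentiableAt_localRep xe H hy)
      fun i => differentiableAt_localRep xe (C i) hy
  obtain ⟨V₁, hV₁, htrap⟩ := exists_trapped_integralCurve hr hrR hRs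
    (fun y hy => (hfd y (hRt hy)).differentiableAt.differentiableWithinAt)
    (fun y hy => by
      have hz : ∀ i, fderiv ℝ (localRep xe (C i)) y (localField xe X y) = 0 := fun i => by
        rw [fderiv_localRep_localField (C i) (hRt hy), hC]
      have hz' : fderiv ℝ (localRep xe H) y (localField xe X y) = 0 := by
        rw [fderiv_localRep_localField H (hRt hy), hH]
      rw [(hfd y (hRt hy)).fderiv]
      simp only [add_apply, sub_apply, smul_apply, sum_apply, hz, hz', smul_zero,
        Finset.sum_const_zero, sub_zero, add_zero])
    hsphere
  have hΦc : Continuous Φ := by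
    have h1 : Continuous H := H.contMDiff.continuous
    have h2 : ∀ i, Continuous (C i) := fun i => (C i).contMDiff.continuous
    have : Continuous fun x => H x - ∑ i, σ i * C i x + K / 2 * ∑ i, (C i x - a i) ^ 2 := by
      fun_prop
    exact this
  obtain ⟨m, hm, hmle⟩ := exists_gap_of_isCompact (isCompact_sphere y₀ r)
    (hΦc.comp_continuousOn ((continuousOn_extChartAt_symm xe).mono
      (Metric.sphere_subset_closedBall.trans hcbt))) hsphere
  rw [Function.comp_apply, hsymm] at hm
  set B : Set M := φ.source ∩ φ ⁻¹' Metric.ball y₀ r with hB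
  have hBo : IsOpen B := (continuousOn_extChartAt xe).isOpen_inter_preimage
    (isOpen_extChartAt_source xe) Metric.isOpen_ball
  have hBmem : xe ∈ B := ⟨hxs, Metric.mem_ball_self hr⟩
  have hBU : B ⊆ U := by
    rintro p ⟨hp, hpb⟩
    have := hδU _ (Metric.ball_subset_ball hrδ.le hpb)
    rwa [φ.left_inv hp] at this
  -- Compact in a Hausdorff space, so closed in M: a path leaving `B` must meet the image of the
  -- sphere, even if it would leave the chart.
  have hKc : IsClosed (φ.symm '' Metric.closedBall y₀ r) :=
    ((isCompact_closedBall y₀ r).image_of_continuousOn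
      ((continuousOn_extChartAt_symm xe).mono hcbt)).isClosed
  -- The first factor yields a global solution; the second confines every solution, without appeal
  -- to uniqueness.
  refine ⟨(φ.source ∩ φ ⁻¹' V₁) ∩ ({x | Φ x < m} ∩ B), ?_, fun x₀ hx₀ => ⟨?_, ?_⟩⟩
  · refine Filter.inter_mem (Filter.inter_mem (extChartAt_source_mem_nhds xe)
      ((continuousAt_extChartAt xe).preimage_mem_nhds hV₁))
      (Filter.inter_mem ((isOpen_lt hΦc continuous_const).mem_nhds hm) (hBo.mem_nhds hBmem))
  · obtain ⟨c, hc0, hc⟩ := htrap (φ x₀) hx₀.1.2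
    refine ⟨φ.symm ∘ c, ?_, fun t _ => ?_⟩
    · rw [Function.comp_apply, hc0, φ.left_inv hx₀.1.1]
    · exact (hasMFDerivAt_symm_comp (hcbt (Metric.ball_subset_closedBall (hc t).1)) rfl _
        (hc t).2).hasMFDerivWithinAt
  · intro γ T h0 hγ t ht
    refine hBU (mapsTo_of_disjoint_boundary isPreconnected_Icc hγ.continuousOn hBo hKc ?_ ?_
      (Set.left_mem_Icc.2 (ht.1.trans ht.2)) (by rw [h0]; exact hx₀.2.2) t ht)
    · rintro p ⟨hp, hpb⟩
      exact ⟨φ p, Metric.ball_subset_closedBall hpb, φ.left_inv hp⟩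
    · rintro s hs ⟨⟨y, hy, hys⟩, hnot⟩
      have hysph : y ∈ Metric.sphere y₀ r := by
        rw [← Metric.closedBall_sdiff_ball]
        refine ⟨hy, fun hyb => hnot ?_⟩
        rw [← hys]
        refine ⟨φ.map_target (hcbt hy), ?_⟩
        rw [Set.mem_preimage, φ.right_inv (hcbt hy)]
        exact hyb
      have h1 : m ≤ Φ (γ s) := by
        rw [← hys]
        exact hmle y hysph
      have h2 : Φ (γ s) = Φ (γ 0) := by
        simp only [hΦ, augmented, eq_of_isMIntegralCurveOn hH hγ hs,
          fun i => eq_of_isMIntegralCurveOn (hC i) hγ hs]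
      rw [h2, h0] at h1
      exact absurd hx₀.2.1 (not_lt.2 h1)

end

end HamiltonPoisson

end

/-! ### The stability theorem. -/

open HamiltonPoisson in
theorem theorem5p2 {n : ℕ} {M : Type*} [TopologicalSpace M]
    [ChartedSpace (EuclideanSpace ℝ (Fin n)) M] [IsManifold (𝓡 n) ∞ M]
    [T2Space M] [ParacompactSpace M]
    (P : PoissonStructure n M) (g : RiemannianMetricOn n M)
    {k : ℕ} (C : Fin k → SmoothFun n M) (hC : ∀ i, P.IsCasimir (C i))
    (H : SmoothFun n M) (X_H : ∀ x : M, TangentSpace (𝓡 n) x)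
    (hX : P.IsHamiltonianVectorField H X_H)
    (S : Set M) (hS : IsRegularSymplecticLeaf P C S)
    (xe : M) (hxe : xe ∈ S) (heq : X_H xe = 0)
    (hpos : ∀ v ∈ tangentTo (n := n) S xe, v ≠ 0 →
      0 < hess g H xe v v
        - ∑ i, lagrangeMultiplier g (fun j => (C j : M → ℝ)) H i xe * hess g (C i) xe v v) :
    IsStableEquilibrium X_H xe := by
  obtain ⟨c, hreg, U, hU, rfl⟩ := hS.isOpen_in_regular_level
  -- A common zero of the dC_i is tangent to the leaf, hence characteristic, and there dH vanishes.
  have hker : ∀ v : TangentSpace (𝓡 n) xe, (∀ i, differential n (C i) xe v = 0) →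
      differential n H xe v = 0 := fun v hv =>
    PoissonStructure.differential_eq_zero_of_equilibrium hX heq
      (hS.tangent_eq xe hxe ▸ mem_tangentTo_of_regular hreg hU hxe hv)
  obtain ⟨σ, hσ⟩ : ∃ σ : Fin k → ℝ, ∀ v : TangentSpace (𝓡 n) xe,
      differential n H xe v = ∑ i, σ i * differential n (C i) xe v :=
    exists_coeff_of_ker_le (V := TangentSpace (𝓡 n) xe)
      (fun i => (mfderiv (𝓡 n) 𝓘(ℝ, ℝ) (C i) xe).toLinearMap)
      (mfderiv (𝓡 n) 𝓘(ℝ, ℝ) H xe).toLinearMap hker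
  have hmult : ∀ i, lagrangeMultiplier g (fun j => (C j : M → ℝ)) H i xe = σ i :=
    lagrangeMultiplier_eq g _ H xe σ (hreg xe hxe.2) hσ
  simp only [hmult] at hpos
  have hxs : xe ∈ (extChartAt (𝓡 n) xe).source := mem_extChartAt_source xe
  have hyt : extChartAt (𝓡 n) xe xe ∈ (extChartAt (𝓡 n) xe).target := mem_extChartAt_target xe
  have hnear := extChartAt_target_mem_nhds (I := 𝓡 n) xe
  have hcrit : ∀ η, fderiv ℝ (localRep xe H) (extChartAt (𝓡 n) xe xe) η
      = ∑ i, σ i * fderiv ℝ (localRep xe (C i)) (extChartAt (𝓡 n) xe xe) η := by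
    intro η
    obtain ⟨v, rfl⟩ := chartDeriv_self_surjective xe η
    have := hσ v
    simpa only [differential_eq_fderiv_localRep hxs] using this
  obtain ⟨K, r, hr, hmin⟩ := exists_strict_min_augmented (h := localRep xe H)
    (q := fun i => localRep xe (C i)) σ (y₀ := extChartAt (𝓡 n) xe xe)
    (Filter.mem_of_superset hnear fun y hy => differentiableAt_localRep xe H hy)
    (Filter.mem_of_superset hnear fun y hy i => differentiableAt_localRep xe (C i) hy)
    (differentiableAt_fderiv_localRep xe H hyt)
    (fun i => differentiableAt_fderiv_localRep xe (C i) hyt)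
    (ContinuousLinearMap.ext fun η => by simpa [sum_apply] using hcrit η)
    (by
      intro η hη hηker
      obtain ⟨v, rfl⟩ := chartDeriv_self_surjective xe η
      have hv : v ∈ tangentTo (n := n) (U ∩ levelSet C c) xe :=
        mem_tangentTo_of_regular hreg hU hxe fun i =>
          (differential_eq_fderiv_localRep hxs (C i) v).trans (hηker i)
      have h := hpos v hv (by rintro rfl; exact hη (map_zero _))
      -- `hcrit` rewrites the Christoffel term of H as the σ-combination of those of the C_i,
      -- leaving only coordinate second derivatives.
      simp only [hess_self_eq, mul_sub, Finset.sum_sub_distrib, hcrit] at h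
      linarith)
  refine isStableEquilibrium_of_strict_min heq (exists_contDiffOn_localField hX xe)
    (H := H) (C := C) (fun x => (hX H x).trans (P.bracket_self H x)) (fun i x => ?_) hr hmin
  rw [hX (C i) x, hC i H]
  rfl
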